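/- Let $G$ be a topological group whose topology is given by a left-invariant metric $d$. Write $C_b(G)$ for the Banach space of bounded continuous complex-valued functions on $G$ with the supremum norm, and call $f\in C_b(G)$ *weakly almost periodic* if the set of its left translates $\{f_x : x\in G\}$, $f_x(y)=f(xy)$, is relatively weakly compact in $C_b(G)$. Suppose that $G$ is *reflexively representable*, that is, $G$ has one of the following two properties (which are known to be equivalent): (1) there is a topological isomorphism of $G$ onto a subgroup of the group of linear isometries of a (real or complex) reflexive Banach space $E$, equipped with the weak operator topology; (2) the topology of $G$ is induced by the weakly almost periodic functions, i.e. it is the coarsest topology on $G$ for which all of them are continuous. Then there is a left-invariant metric $\delta$ on $G$ such that (a) $\delta$ is *stable*: for all $\delta$-bounded sequences $(s_n)_{n\in\mathbb N}$, $(t_m)_{m\in\mathbb N}$ in $G$ and all ultrafilters $\mathcal U,\mathcal V$ on $\mathbb N$, $$\lim_{n,\mathcal U}\lim_{m,\mathcal V}\delta(s_n,t_m)=\lim_{m,\mathcal V}\lim_{n,\mathcal U}\delta(s_n,t_m);$$ (b) $\delta$ is *uniformly equivalent* to $d$: for every $\varepsilon>0$ there is $\eta>0$ such that for all $x,y\in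 G$, $d(x,y)<\eta$ implies $\delta(x,y)<\varepsilon$, and $\delta(x,y)<\eta$ implies $d(x,y)<\varepsilon$. -/

import Mathlib

universe u v w

open Filter Topology
open scoped BoundedContinuousFunction

/-- The left translate `f_x(y) = f (x * y)` of a bounded continuous function on a group. -/
noncomputable def leftTranslate {G : Type*} [Group G] [TopologicalSpace G] [IsTopologicalGroup G]
    (f : G →ᵇ ℂ) (x : G) : G →ᵇ ℂ :=
  f.compContinuous (ContinuousMap.mulLeft x)

/-- `f ∈ C_b(G)` is weakly almost periodic if the set of its left translates is relatively compact
in `C_b(G)` (with the supremum norm) for the weak topology. -/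
def IsWeaklyAlmostPeriodic {G : Type*} [Group G] [TopologicalSpace G] [IsTopologicalGroup G]
    (f : G →ᵇ ℂ) : Prop :=
  IsCompact (closure (toWeakSpace ℂ (G →ᵇ ℂ) '' Set.range (leftTranslate f)))

/-- The topology of `G` is induced by `WAP(G)`: it is the coarsest topology for which all weakly
almost periodic functions are continuous. -/
def TopologyInducedByWAP (G : Type*) [Group G] [t : TopologicalSpace G] [IsTopologicalGroup G] :
    Prop :=
  t = ⨅ f : {f : G →ᵇ ℂ // IsWeaklyAlmostPeriodic f},
    TopologicalSpace.induced (fun x => f.1 x) inferInstance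

/-- A normed space is reflexive if the canonical map into its bidual is onto. -/
def IsReflexiveSpace (𝕜 E : Type*) [RCLike 𝕜] [NormedAddCommGroup E] [NormedSpace 𝕜 E] : Prop :=
  Function.Surjective (NormedSpace.inclusionInDoubleDual 𝕜 E)

/-- There is a topological isomorphism of `G` onto a subgroup of the group of linear isometries
of a reflexive Banach space `E` over `𝕜`, equipped with the weak operator topology. -/
def HasReflexiveRepresentation (𝕜 : Type w) [RCLike 𝕜]
    (G : Type u) [Group G] [TopologicalSpace G] : Prop :=
  ∃ (E : Type v) (_ : NormedAddCommGroup E) (_ : NormedSpace 𝕜 E) (_ : CompleteSpace E),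
    IsReflexiveSpace 𝕜 E ∧
    ∃ π : G →* (E ≃ₗᵢ[𝕜] E),
      IsEmbedding fun g : G =>
        (ContinuousLinearMapWOT.ofCLM ((π g).toContinuousLinearEquiv : E →L[𝕜] E) : E →WOT[𝕜] E)

/-- Reflexive representability. Two properties of a topological group, known to be equivalent,
define this notion: being represented by isometries of a reflexive Banach space, and having
its topology induced by the weakly almost periodic functions. Their equivalence is a theorem, not
built in here: either of the two is accepted. -/
def IsReflexivelyRepresentable (𝕜 : Type w) [RCLike 𝕜]
    (G : Type u) [Group G] [TopologicalSpace G] [IsTopologicalGroup G] : Prop :=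
  HasReflexiveRepresentation.{u, v, w} 𝕜 G ∨ TopologyInducedByWAP G

/-- Left invariance of a distance function on a group. -/
def IsLeftInvariantDist {G : Type*} [Group G] (d : G → G → ℝ) : Prop :=
  ∀ g x y : G, d (g * x) (g * y) = d x y

/-- Stability: for all bounded sequences `s`, `t` and all ultrafilters `U`, `V` on `ℕ`, the two
iterated limits of `d (s n) (t m)` exist and are equal (`a n` and `b m` are the inner limits,
`L` is the common value of the outer ones). For a metric, existence is automatic. -/
def IsStableDist {G : Type*} [Group G] (d : G → G → ℝ) : Prop :=
  ∀ s t : ℕ → G, (∃ M : ℝ, ∀ n, d 1 (s n) ≤ M ∧ d 1 (t n) ≤ M) →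
    ∀ U V : Ultrafilter ℕ, ∃ (a b : ℕ → ℝ) (L : ℝ),
      (∀ n, Tendsto (fun m => d (s n) (t m)) V (𝓝 (a n))) ∧ Tendsto a U (𝓝 L) ∧
      (∀ m, Tendsto (fun n => d (s n) (t m)) U (𝓝 (b m))) ∧ Tendsto b V (𝓝 L)

/-- Uniform equivalence of two distance functions. -/
def UniformlyEquivalentDist {X : Type*} (h₁ h₂ : X → X → ℝ) : Prop :=
  ∀ ε > 0, ∃ η > 0, ∀ x y : X, (h₁ x y < η → h₂ x y < ε) ∧ (h₂ x y < η → h₁ x y < ε)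

/-! Weak compactness (of orbits of functions, or of balls in a reflexive space) makes iterated
limits of `F (x * y)` interchangeable for maps `F` inducing the topology. Combining countably many
scalar functions of `F` gives a bounded symmetric gauge `f`, again with double limits, whose sets
`{f < η}` form a neighbourhood base at 1 (`exists_continuous_gauge`). A Baire category argument
shows that `f (x * z)` tends to `f x` uniformly in `x` as `z → 1` (`eventually_abs_mul_sub_le`),
whence `f (x * y) ≤ f x + ε + C * f y` with `C` depending on `ε` only. This is enough to find a
continuous `h` with `h ∘ f` subadditive (`exists_continuous_subadditive_comp`). Since continuous
maps preserve double limits, `ρ = h ∘ f` is a length function for which `ρ (x⁻¹ * y)` is stable. -/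

/-- The iterated limits of `F x y` along any two ultrafilters exist and are equal. -/
def HasDoubleLimits {X Y Z : Type*} [TopologicalSpace Z] (F : X → Y → Z) : Prop :=
  ∀ (U : Ultrafilter X) (V : Ultrafilter Y), ∃ (a : X → Z) (b : Y → Z) (L : Z),
    (∀ x, Tendsto (F x) V (𝓝 (a x))) ∧ Tendsto a U (𝓝 L) ∧
    (∀ y, Tendsto (fun x => F x y) U (𝓝 (b y))) ∧ Tendsto b V (𝓝 L)

/-! ### Permanence of the double limit property. -/

namespace HasDoubleLimits

variable {X Y Z : Type*} [TopologicalSpace Z] {F : X → Y → Z}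

lemma swap (hF : HasDoubleLimits F) : HasDoubleLimits fun y x => F x y := by
  intro U V
  obtain ⟨a, b, L, ha, haL, hb, hbL⟩ := hF V U
  exact ⟨b, a, L, hb, hbL, ha, haL⟩

lemma comp {W : Type*} [TopologicalSpace W] (hF : HasDoubleLimits F) {φ : Z → W}
    (hφ : Continuous φ) : HasDoubleLimits fun x y => φ (F x y) := by
  intro U V
  obtain ⟨a, b, L, ha, haL, hb, hbL⟩ := hF U V
  exact ⟨φ ∘ a, φ ∘ b, φ L, fun x => (hφ.tendsto _).comp (ha x), (hφ.tendsto _).comp haL,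
    fun y => (hφ.tendsto _).comp (hb y), (hφ.tendsto _).comp hbL⟩

lemma comap {X' Y' : Type*} (hF : HasDoubleLimits F) (s : X' → X) (t : Y' → Y) :
    HasDoubleLimits fun x y => F (s x) (t y) := by
  intro U V
  obtain ⟨a, b, L, ha, haL, hb, hbL⟩ := hF (U.map s) (V.map t)
  simp only [Ultrafilter.coe_map, tendsto_map'_iff] at ha haL hb hbL
  exact ⟨a ∘ s, b ∘ t, L, fun x => ha (s x), haL, fun y => hb (t y), hbL⟩

lemma pi {I : Type*} {Z : I → Type*} [∀ i, TopologicalSpace (Z i)]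
    {F : ∀ i, X → Y → Z i} (hF : ∀ i, HasDoubleLimits (F i)) :
    HasDoubleLimits fun x y i => F i x y := by
  intro U V
  choose a b L ha haL hb hbL using fun i => hF i U V
  exact ⟨fun x i => a i x, fun y i => b i y, L, fun x => tendsto_pi_nhds.2 fun i => ha i x,
    tendsto_pi_nhds.2 haL, fun y => tendsto_pi_nhds.2 fun i => hb i y, tendsto_pi_nhds.2 hbL⟩

lemma prodMk {W : Type*} [TopologicalSpace W] {F' : X → Y → W} (hF : HasDoubleLimits F)
    (hF' : HasDoubleLimits F') : HasDoubleLimits fun x y => (F x y, F' x y) := by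
  intro U V
  obtain ⟨a, b, L, ha, haL, hb, hbL⟩ := hF U V
  obtain ⟨a', b', L', ha', haL', hb', hbL'⟩ := hF' U V
  exact ⟨fun x => (a x, a' x), fun y => (b y, b' y), (L, L'),
    fun x => (ha x).prodMk_nhds (ha' x), haL.prodMk_nhds haL',
    fun y => (hb y).prodMk_nhds (hb' y), hbL.prodMk_nhds hbL'⟩

/-! ### Baire category and uniform continuity. -/

/-- Every pointwise limit of the columns of `F` is continuous on the closure of the set of
rows. -/
lemma continuous_of_tendsto {F : X → Y → ℝ} (hF : HasDoubleLimits F) (V : Ultrafilter Y)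
    {φ : closure (Set.range F) → ℝ} (hφ : ∀ k, Tendsto (fun y => k.1 y) V (𝓝 (φ k))) :
    Continuous φ := by
  set i : X → closure (Set.range F) := fun x => ⟨F x, subset_closure ⟨x, rfl⟩⟩ with hi
  have hdense : Dense (Set.range i) := by
    rw [Subtype.dense_iff, ← Set.range_comp]
    exact subset_rfl
  -- Double limits only control approach to `p` through rows; as rows are dense and `ℝ` is regular,
  -- this suffices for continuity.
  have key : ∀ p, Tendsto φ (𝓝[Set.range i] p) (𝓝 (φ p)) := by
    intro p
    have : 𝓝[Set.range i] p = map i (Filter.comap i (𝓝 p)) := by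
      rw [Filter.map_comap, nhdsWithin]
    rw [this, tendsto_map'_iff, tendsto_iff_ultrafilter]
    intro U hU
    obtain ⟨a, b, L, ha, haL, hb, hbL⟩ := hF U V
    have hip : Tendsto i U (𝓝 p) := tendsto_iff_comap.2 hU
    have hb' : b = p.1 := by
      funext y
      refine tendsto_nhds_unique (hb y) ?_
      exact ((continuous_apply y).comp continuous_subtype_val).tendsto p |>.comp hip
    have ha' : a = φ ∘ i := by
      funext x
      exact tendsto_nhds_unique (ha x) (hφ (i x))
    have hL : L = φ p := tendsto_nhds_unique hbL (hb' ▸ hφ p)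
    rw [← ha', ← hL]
    exact haL
  have hext : extendFrom (Set.range i) φ = φ := by
    funext p
    exact extendFrom_eq (hdense p) (key p)
  rw [← hext]
  exact continuous_extendFrom hdense fun p => ⟨_, key p⟩

/-- Some column of `F` is a point of `ε`-continuity for the uniform distance on columns with
respect to pointwise convergence on the closure of the set of rows. -/
theorem exists_eventually_abs_sub_le [Countable Y] [Nonempty Y] {F : X → Y → ℝ} {M : ℝ}
    (hM : ∀ x y, |F x y| ≤ M) (hF : HasDoubleLimits F) {ε : ℝ} (hε : 0 < ε) :
    ∃ y₀ : Y, ∀ y : ℕ → Y,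
      (∀ k ∈ closure (Set.range F), Tendsto (fun n => k (y n)) atTop (𝓝 (k y₀))) →
      ∀ᶠ n in atTop, ∀ x, |F x (y n) - F x y₀| ≤ ε := by
  set K := closure (Set.range F) with hK
  have hKI : K ⊆ Set.pi Set.univ fun _ => Set.Icc (-M) M :=
    closure_minimal (by rintro _ ⟨x, rfl⟩ y -; exact abs_le.1 (hM x y))
      (isClosed_set_pi fun _ _ => isClosed_Icc)
  have hKc : IsCompact K :=
    (isCompact_univ_pi fun _ => isCompact_Icc).of_isClosed_subset isClosed_closure hKI
  have : CompactSpace K := isCompact_iff_compactSpace.1 hKc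
  set ev : Y → K → ℝ := fun y k => k.1 y with hev
  set S := closure (Set.range ev) with hS
  have hSc : IsCompact S :=
    (isCompact_univ_pi fun _ => isCompact_Icc).of_isClosed_subset isClosed_closure
      (closure_minimal (t := Set.pi Set.univ fun _ => Set.Icc (-M) M)
        (by rintro _ ⟨y, rfl⟩ k -; exact hKI k.2 y (Set.mem_univ _))
        (isClosed_set_pi fun _ _ => isClosed_Icc))
  have : CompactSpace S := isCompact_iff_compactSpace.1 hSc
  have : Nonempty S := ⟨⟨ev (Classical.arbitrary Y), subset_closure ⟨_, rfl⟩⟩⟩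
  have hcont : ∀ φ ∈ S, Continuous φ := by
    intro φ hφ
    have : (Filter.comap ev (𝓝 φ)).NeBot := by
      rw [comap_neBot_iff_frequently]
      exact (mem_closure_iff_frequently.1 hφ)
    have hV : Tendsto ev (Ultrafilter.of (Filter.comap ev (𝓝 φ))) (𝓝 φ) :=
      tendsto_iff_comap.2 (Ultrafilter.of_le _)
    exact hF.continuous_of_tendsto _ fun k => tendsto_pi_nhds.1 hV k
  -- `K` is compact and metrizable, `Y` being countable, so `C(K, ℝ)` is separable. Uniform balls
  -- about a dense sequence are pointwise closed and cover the compact space `S`; by Baire one has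
  -- interior, which contains a column.
  let C : ℕ → Set S := fun n =>
    ⋂ k : K, {φ | |φ.1 k - TopologicalSpace.denseSeq C(K, ℝ) n k| ≤ ε / 2}
  have hC : ∀ n, IsClosed (C n) := fun n => isClosed_iInter fun k =>
    isClosed_le ((((continuous_apply k).comp continuous_subtype_val).sub
      continuous_const).abs) continuous_const
  have hU : ⋃ n, C n = Set.univ := by
    refine Set.eq_univ_of_forall fun φ => Set.mem_iUnion.2 ?_
    obtain ⟨n, hn⟩ := (TopologicalSpace.denseRange_denseSeq C(K, ℝ)).exists_dist_lt
      ⟨φ.1, hcont _ φ.2⟩ (half_pos hε)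
    refine ⟨n, Set.mem_iInter.2 fun k => ?_⟩
    exact (ContinuousMap.dist_apply_le_dist (f := ⟨φ.1, hcont _ φ.2⟩) k).trans hn.le
  obtain ⟨n, ψ, hψ⟩ := nonempty_interior_of_iUnion_of_closed hC hU
  obtain ⟨O, hO, hOC⟩ := isOpen_induced_iff.1 (isOpen_interior (s := C n))
  have hψO : ψ.1 ∈ O := by
    have : ψ ∈ Subtype.val ⁻¹' O := hOC ▸ hψ
    exact this
  obtain ⟨_, hy₀, ⟨y₀, rfl⟩⟩ := mem_closure_iff.1 ψ.2 O hO hψO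
  have hmem : ∀ y, ev y ∈ O →
      ∀ k : K, |ev y k - TopologicalSpace.denseSeq C(K, ℝ) n k| ≤ ε / 2 := by
    intro y hy k
    have h1 : (⟨ev y, subset_closure ⟨y, rfl⟩⟩ : S) ∈ interior (C n) := hOC ▸ hy
    exact Set.mem_iInter.1 (interior_subset h1) k
  refine ⟨y₀, fun y hy => ?_⟩
  have ht : Tendsto (fun m => ev (y m)) atTop (𝓝 (ev y₀)) :=
    tendsto_pi_nhds.2 fun k => hy k.1 k.2
  filter_upwards [ht.eventually (hO.mem_nhds hy₀)] with m hm x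
  have h1 := abs_le.1 (hmem _ hm ⟨F x, subset_closure ⟨x, rfl⟩⟩)
  have h2 := abs_le.1 (hmem _ hy₀ ⟨F x, subset_closure ⟨x, rfl⟩⟩)
  simp only [hev] at h1 h2
  rw [abs_le]
  constructor <;> linarith [h1.1, h1.2, h2.1, h2.2]

/-- A bounded continuous function on a metrizable group with the double limit property is
uniformly continuous for the left uniformity. -/
theorem eventually_abs_mul_sub_le {G : Type*} [Group G] [TopologicalSpace G]
    [IsTopologicalGroup G] [FirstCountableTopology G] {f : G → ℝ} (hf : Continuous f) {M : ℝ}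
    (hM : ∀ x, |f x| ≤ M) (hF : HasDoubleLimits fun x y => f (x * y)) {ε : ℝ} (hε : 0 < ε) :
    ∀ᶠ z in 𝓝 (1 : G), ∀ x, |f (x * z) - f x| ≤ ε := by
  by_contra hcon
  obtain ⟨z, hz, hzε⟩ := exists_seq_forall_of_frequently (not_eventually.1 hcon)
  -- A countable index set containing every `y₀ * z n`, wherever `y₀` falls.
  set H := (FreeGroup.lift z).range with hH
  have hzH : ∀ n, z n ∈ H := fun n => ⟨FreeGroup.of n, FreeGroup.lift_apply_of⟩
  have : Countable (FreeGroup ℕ) := inferInstanceAs (Countable (Quot _))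
  have : Countable H := Set.countable_range (FreeGroup.lift z)
  obtain ⟨y₀, hy₀⟩ := exists_eventually_abs_sub_le (F := fun (x : G) (y : H) => f (x * y))
    (fun x y => hM _) (hF.comap id Subtype.val) hε
  have hev := hy₀ (fun n => y₀ * ⟨z n, hzH n⟩) (by
    intro k hk
    have : (Filter.comap (fun (x : G) (y : H) => f (x * y)) (𝓝 k)).NeBot := by
      rw [comap_neBot_iff_frequently]
      exact (mem_closure_iff_frequently.1 hk)
    set U := Ultrafilter.of (Filter.comap (fun (x : G) (y : H) => f (x * y)) (𝓝 k))
    have hU : Tendsto (fun (x : G) (y : H) => f (x * y)) U (𝓝 k) :=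
      tendsto_iff_comap.2 (Ultrafilter.of_le _)
    rw [tendsto_iff_ultrafilter]
    intro W hW
    obtain ⟨a, b, L, ha, haL, hb, hbL⟩ := hF.comap id (fun n => (y₀ : G) * z n) U W
    have ha' : a = fun x => f (x * y₀) := by
      funext x
      refine tendsto_nhds_unique (ha x) ?_
      have h1 : Tendsto (fun n => x * ((y₀ : G) * z n)) W (𝓝 (x * (y₀ * 1))) :=
        ((hz.mono_left hW).const_mul _).const_mul _
      rw [mul_one] at h1
      exact (hf.tendsto _).comp h1
    have hb' : b = fun n => k (y₀ * ⟨z n, hzH n⟩) := by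
      funext n
      exact tendsto_nhds_unique (hb n) (tendsto_pi_nhds.1 hU _)
    have hL : L = k y₀ := tendsto_nhds_unique haL (ha' ▸ tendsto_pi_nhds.1 hU y₀)
    rw [hb', hL] at hbL
    exact hbL)
  obtain ⟨n, hn⟩ := hev.exists
  refine hzε n fun x => ?_
  -- The estimate is uniform over all of `G`, so `y₀` can be translated away.
  have := hn (x * (y₀ : G)⁻¹)
  simpa [← mul_assoc] using this

end HasDoubleLimits

/-! ### From a gauge to a length function. -/

/-- A nonnegative function `f` on a group which is uniformly continuous with respect to itself
becomes subadditive after composition with a continuous function vanishing only at `0`. -/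
theorem exists_continuous_subadditive_comp {G : Type*} [Group G] {f : G → ℝ} (hf : ∀ x, 0 ≤ f x)
    (hC : ∀ ε > 0, ∃ C ≥ 0, ∀ x y,
      f (x * y) ≤ f x + ε + C * f y ∧ f (x * y) ≤ f y + ε + C * f x) :
    ∃ h : ℝ → ℝ, Continuous h ∧ h 0 = 0 ∧ (∀ t ≥ 0, min 1 t ≤ h t) ∧
      ∀ x y, h (f (x * y)) ≤ h (f x) + h (f y) := by
  -- Two terms of index `k + 1` must dominate one of index `k` with error `a (k + 1) / 4`: this
  -- holds as `3/2 + 1/4 < 2`.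
  set a : ℕ → ℝ := fun n => (2 / 3) ^ n with ha
  have ha0 : ∀ n, 0 < a n := fun n => by positivity
  have hasucc : ∀ n, a n = 3 / 2 * a (n + 1) := fun n => by simp only [ha, pow_succ]; ring
  have step : ∀ (n : ℕ) (β : {β : ℝ // 0 ≤ β}), ∃ β' : {β : ℝ // 0 ≤ β},
      β.1 ≤ β'.1 ∧ 1 ≤ β'.1 ∧ ∀ x y,
        β.1 * f (x * y) ≤ β.1 * f x + a (n + 1) / 4 + β'.1 * f y ∧
        β.1 * f (x * y) ≤ β.1 * f y + a (n + 1) / 4 + β'.1 * f x := by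
    rintro n ⟨β, hβ⟩
    obtain ⟨C, hC0, hC⟩ := hC (a (n + 1) / 4 / (β + 1)) (by have := ha0 (n + 1); positivity)
    have hβC : 0 ≤ β * C := mul_nonneg hβ hC0
    have hε : β * (a (n + 1) / 4 / (β + 1)) ≤ a (n + 1) / 4 := by
      rw [← mul_div_assoc, div_le_iff₀ (by linarith), mul_comm]
      exact mul_le_mul_of_nonneg_left (by linarith) (by have := ha0 (n + 1); positivity)
    refine ⟨⟨β + β * C + 1, by linarith⟩, by simp only; linarith, by simp only; linarith, ?_⟩
    have aux : ∀ p q r : ℝ, 0 ≤ q → r ≤ p + a (n + 1) / 4 / (β + 1) + C * q →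
        β * r ≤ β * p + a (n + 1) / 4 + (β + β * C + 1) * q := by
      intro p q r hq hr
      have h1 := mul_le_mul_of_nonneg_left hr hβ
      have h2 := mul_nonneg hβ hq
      nlinarith
    exact fun x y => ⟨aux _ _ _ (hf y) (hC x y).1, aux _ _ _ (hf x) (hC x y).2⟩
  choose next hnext using step
  -- Slope 0 at index 0 caps `h` at `a 0 = 1`; all later slopes are at least 1.
  set B : ℕ → {β : ℝ // 0 ≤ β} := fun n => Nat.rec ⟨0, le_rfl⟩ next n with hB
  set b : ℕ → ℝ := fun n => (B n).1 with hb
  have hb0 : b 0 = 0 := rfl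
  have hbnn : ∀ n, 0 ≤ b n := fun n => (B n).2
  have hbs : ∀ n, b n ≤ b (n + 1) ∧ 1 ≤ b (n + 1) ∧ ∀ x y,
        b n * f (x * y) ≤ b n * f x + a (n + 1) / 4 + b (n + 1) * f y ∧
        b n * f (x * y) ≤ b n * f y + a (n + 1) / 4 + b (n + 1) * f x := fun n => hnext n (B n)
  have hbmono : Monotone b := monotone_nat_of_le_succ fun n => (hbs n).1
  set h : ℝ → ℝ := fun t => ⨅ n, (a n + b n * |t|) with hh
  have hterm : ∀ t n, 0 ≤ a n + b n * |t| := fun t n =>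
    add_nonneg (ha0 n).le (mul_nonneg (hbnn n) (abs_nonneg t))
  have hbdd : ∀ t, BddBelow (Set.range fun n => a n + b n * |t|) := fun t =>
    ⟨0, by rintro _ ⟨n, rfl⟩; exact hterm t n⟩
  have hle : ∀ t n, h t ≤ a n + b n * |t| := fun t n => ciInf_le (hbdd t) n
  have hnn : ∀ t, 0 ≤ h t := fun t => le_ciInf (hterm t)
  have hsmall : ∀ ε > 0, ∃ η > 0, ∀ t, |t| < η → h t < ε := by
    intro ε hε
    obtain ⟨n, hn⟩ := exists_pow_lt_of_lt_one (half_pos hε) (show (2 / 3 : ℝ) < 1 by norm_num)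
    refine ⟨ε / 2 / (b n + 1), by have := hbnn n; positivity, fun t ht => ?_⟩
    have h1 : b n * |t| ≤ ε / 2 := by
      rw [lt_div_iff₀ (by have := hbnn n; positivity)] at ht
      nlinarith [abs_nonneg t]
    have h2 : a n < ε / 2 := hn
    linarith [hle t n]
  have hzero : h 0 = 0 := by
    refine le_antisymm (le_of_forall_pos_lt_add fun ε hε => ?_) (hnn 0)
    obtain ⟨η, hη, H⟩ := hsmall ε hε
    simpa using H 0 (by simpa using hη)
  have hadd : ∀ s t, h s ≤ h t + h (s - t) := by
    intro s t
    have hst : |s| ≤ |t| + |s - t| := by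
      calc |s| = |t + (s - t)| := by ring_nf
        _ ≤ _ := abs_add_le _ _
    refine le_ciInf_add_ciInf fun n m => ?_
    rcases le_total n m with hnm | hnm
    · have h1 := mul_le_mul_of_nonneg_left hst (hbnn n)
      have h2 := mul_le_mul_of_nonneg_right (hbmono hnm) (abs_nonneg (s - t))
      linarith [hle s n, ha0 m]
    · have h1 := mul_le_mul_of_nonneg_left hst (hbnn m)
      have h2 := mul_le_mul_of_nonneg_right (hbmono hnm) (abs_nonneg t)
      linarith [hle s m, ha0 n]
  refine ⟨h, ?_, hzero, ?_, ?_⟩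
  · rw [Metric.continuous_iff]
    intro t ε hε
    obtain ⟨η, hη, H⟩ := hsmall ε hε
    refine ⟨η, hη, fun s hs => ?_⟩
    rw [Real.dist_eq] at hs ⊢
    have h1 := H (s - t) hs
    have h2 := H (t - s) (by rwa [abs_sub_comm])
    rw [abs_lt]
    constructor <;> linarith [hadd s t, hadd t s]
  · intro t ht
    refine le_ciInf fun n => ?_
    rw [abs_of_nonneg ht]
    cases n with
    | zero => exact (min_le_left _ _).trans (by simp [ha, hb0])
    | succ n =>
      refine (min_le_right _ _).trans ?_
      nlinarith [ha0 (n + 1), (hbs n).2.1]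
  · intro x y
    have habs : ∀ z, |f z| = f z := fun z => abs_of_nonneg (hf z)
    have aux : ∀ n k, n ≤ k → ∀ p q r : ℝ, 0 ≤ q →
        b k * r ≤ b k * p + a (k + 1) / 4 + b (k + 1) * q →
        b n * r ≤ b n * p + a (k + 1) / 4 + b (k + 1) * q := by
      intro n k hnk p q r hq hr
      have hbn : b n ≤ b k := hbmono hnk
      rcases le_total r p with hrp | hrp
      · have h1 := mul_le_mul_of_nonneg_left hrp (hbnn n)
        have h2 := mul_nonneg (hbnn (k + 1)) hq
        linarith [ha0 (k + 1)]
      · have h1 := mul_le_mul_of_nonneg_right hbn (sub_nonneg.2 hrp)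
        linarith
    refine le_ciInf_add_ciInf fun n m => ?_
    -- For distinct indices the smaller one bounds the product, the other `a` absorbing the error;
    -- for equal positive indices the preceding index is used.
    rcases lt_trichotomy n m with hnm | rfl | hnm
    · obtain ⟨k, rfl⟩ : ∃ k, m = k + 1 := ⟨m - 1, by omega⟩
      have h0 := hle (f (x * y)) n
      simp only [habs] at h0 ⊢
      have h1 := aux n k (by omega) _ _ _ (hf y) ((hbs k).2.2 x y).1
      linarith [ha0 (k + 1)]
    · cases n with
      | zero =>
        have h0 := hle (f (x * y)) 0
        simp only [hb0, zero_mul, add_zero] at h0 ⊢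
        linarith [ha0 0]
      | succ k =>
        have h0 := hle (f (x * y)) k
        simp only [habs] at h0 ⊢
        have h1 := ((hbs k).2.2 x y).1
        have h2 := mul_le_mul_of_nonneg_right (hbs k).1 (hf x)
        linarith [hasucc k, ha0 (k + 1)]
    · obtain ⟨k, rfl⟩ : ∃ k, n = k + 1 := ⟨n - 1, by omega⟩
      have h0 := hle (f (x * y)) m
      simp only [habs] at h0 ⊢
      have h1 := aux m k (by omega) _ _ _ (hf x) ((hbs k).2.2 x y).2
      linarith [ha0 (k + 1)]

/-! ### Double limits from weak compactness. -/

section WeakCompactness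

variable {𝕜 : Type*} [RCLike 𝕜] {X : Type*} [NormedAddCommGroup X] [NormedSpace 𝕜 X]

/-- A bounded family of functionals has weak-* limits along ultrafilters. -/
lemma exists_forall_tendsto_of_norm_le {ι : Type*} (U : Ultrafilter ι) {T : ι → StrongDual 𝕜 X}
    {R : ℝ} (hT : ∀ i, ‖T i‖ ≤ R) :
    ∃ χ : StrongDual 𝕜 X, ∀ u, Tendsto (fun i => T i u) U (𝓝 (χ u)) := by
  obtain ⟨χ, -, hχ⟩ := (WeakDual.isCompact_closedBall (𝕜 := 𝕜) (E := X) 0 R).ultrafilter_le_nhds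
    (U.map fun i => StrongDual.toWeakDual (T i)) (by
      rw [Ultrafilter.coe_map, le_principal_iff]
      refine Filter.mem_map.2 (univ_mem' fun i => ?_)
      simpa using hT i)
  refine ⟨WeakDual.toStrongDual χ, fun u => ?_⟩
  exact ((WeakDual.eval_continuous u).tendsto χ).comp hχ

/-- The pairing of a family having weak limits along all ultrafilters with a bounded family of
functionals has the double limit property. -/
lemma hasDoubleLimits_pairing {A B : Type*} {S : A → X}
    (hS : ∀ U : Ultrafilter A, ∃ w, ∀ ψ : StrongDual 𝕜 X, Tendsto (fun x => ψ (S x)) U (𝓝 (ψ w)))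
    {T : B → StrongDual 𝕜 X} {R : ℝ} (hT : ∀ y, ‖T y‖ ≤ R) :
    HasDoubleLimits fun x y => T y (S x) := by
  intro U V
  obtain ⟨w, hw⟩ := hS U
  obtain ⟨χ, hχ⟩ := exists_forall_tendsto_of_norm_le V hT
  exact ⟨fun x => χ (S x), fun y => T y w, χ w, fun x => hχ _, hw χ, fun y => hw (T y), hχ w⟩

/-- Banach–Alaoglu in the bidual; reflexivity brings the limit back to `X`. -/
lemma IsReflexiveSpace.exists_forall_tendsto {ι : Type*} (hX : IsReflexiveSpace 𝕜 X) {S : ι → X}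
    {R : ℝ} (hS : ∀ i, ‖S i‖ ≤ R) (U : Ultrafilter ι) :
    ∃ w, ∀ ψ : StrongDual 𝕜 X, Tendsto (fun i => ψ (S i)) U (𝓝 (ψ w)) := by
  obtain ⟨χ, hχ⟩ := exists_forall_tendsto_of_norm_le U
    (T := fun i => NormedSpace.inclusionInDoubleDual 𝕜 X (S i)) (R := R) fun i =>
      (NormedSpace.double_dual_bound 𝕜 X (S i)).trans (hS i)
  obtain ⟨w, rfl⟩ := hX χ
  exact ⟨w, hχ⟩

end WeakCompactness

/-- A weakly almost periodic function has the double limit property. -/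
lemma IsWeaklyAlmostPeriodic.hasDoubleLimits {G : Type*} [Group G] [TopologicalSpace G]
    [IsTopologicalGroup G] {f : G →ᵇ ℂ} (hf : IsWeaklyAlmostPeriodic f) :
    HasDoubleLimits fun x y => f (x * y) := by
  refine hasDoubleLimits_pairing (𝕜 := ℂ) (S := leftTranslate f)
    (T := fun y => BoundedContinuousFunction.evalCLM ℂ y) (R := 1) (fun U => ?_) fun y => ?_
  · obtain ⟨w, -, hw⟩ := hf.ultrafilter_le_nhds
      (U.map fun x => toWeakSpace ℂ (G →ᵇ ℂ) (leftTranslate f x)) (by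
        rw [Ultrafilter.coe_map, le_principal_iff]
        exact Filter.mem_map.2 (univ_mem' fun x => subset_closure ⟨_, ⟨x, rfl⟩, rfl⟩))
    exact ⟨(toWeakSpace ℂ (G →ᵇ ℂ)).symm w, fun ψ =>
      ((WeakBilin.eval_continuous (topDualPairing ℂ (G →ᵇ ℂ)).flip ψ).tendsto w).comp hw⟩
  · refine ContinuousLinearMap.opNorm_le_bound _ zero_le_one fun g => ?_
    rw [one_mul]
    exact g.norm_coe_le_norm y

/-! ### Construction of the gauge. -/

/-- If the topology of a group is induced by a map with the double limit property, then functions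
with the double limit property separate the identity from closed sets. -/
lemma HasDoubleLimits.exists_continuous_of_mem_nhds {G Z : Type*} [Group G] [TopologicalSpace G]
    [TopologicalSpace Z] [CompletelyRegularSpace Z] {F : G → Z} (hF : IsInducing F)
    (hd : HasDoubleLimits fun x y => F (x * y)) {N : Set G} (hN : N ∈ 𝓝 1) :
    ∃ f : G → ℝ, Continuous f ∧ (HasDoubleLimits fun x y => f (x * y)) ∧
      (∀ x, f x ∈ Set.Icc (0 : ℝ) 1) ∧ f 1 = 0 ∧ ∀ x ∉ N, f x = 1 := by
  rw [hF.nhds_eq_comap] at hN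
  obtain ⟨W, hW, hWN⟩ := hN
  obtain ⟨O, hOW, hO, h1⟩ := mem_nhds_iff.1 hW
  obtain ⟨φ, hφ, hφ1, hφO⟩ :=
    CompletelyRegularSpace.completely_regular (F 1) Oᶜ hO.isClosed_compl (by simpa using h1)
  have hc : Continuous fun z => (φ z : ℝ) := continuous_subtype_val.comp hφ
  refine ⟨fun x => φ (F x), hc.comp hF.continuous, hd.comp hc, fun x => (φ (F x)).2, by simp [hφ1],
    fun x hx => ?_⟩
  have : F x ∈ Oᶜ := fun h => hx (hWN (hOW h))
  simp [hφO this]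

/-- A metrizable group whose topology is induced by a map with the double limit property carries a
symmetric gauge with the double limit property. -/
lemma HasDoubleLimits.exists_gauge {G Z : Type*} [Group G] [TopologicalSpace G]
    [IsTopologicalGroup G] [FirstCountableTopology G]
    [TopologicalSpace Z] [CompletelyRegularSpace Z] {F : G → Z} (hF : IsInducing F)
    (hd : HasDoubleLimits fun x y => F (x * y)) :
    ∃ f : G → ℝ, Continuous f ∧ (HasDoubleLimits fun x y => f (x * y)) ∧
      (∃ M, ∀ x, |f x| ≤ M) ∧ (∀ x, 0 ≤ f x) ∧ f 1 = 0 ∧ (∀ x, f x⁻¹ = f x) ∧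
      ∀ N ∈ 𝓝 (1 : G), ∃ η > 0, ∀ x, f x < η → x ∈ N := by
  obtain ⟨N, hN⟩ := (𝓝 (1 : G)).exists_antitone_basis
  choose g hgc hgd hg01 hg1 hgN using fun n =>
    HasDoubleLimits.exists_continuous_of_mem_nhds hF hd (hN.1.mem_of_mem (i := n) trivial)
  -- Truncation by 1 makes `Φ` continuous on the whole product, so that `comp` applies; the second
  -- coordinate will hold the value at the inverse, for symmetry.
  set Φ : (ℕ → ℝ × ℝ) → ℝ := fun z =>
    ∑' n, (1 / 2 : ℝ) ^ n * (min 1 |(z n).1| + min 1 |(z n).2|) with hΦ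
  have hsum : Summable fun n : ℕ => (1 / 2 : ℝ) ^ n * 2 :=
    (summable_geometric_of_lt_one (by norm_num) (by norm_num)).mul_right 2
  have hnn : ∀ z : ℕ → ℝ × ℝ, ∀ n,
      0 ≤ (1 / 2 : ℝ) ^ n * (min 1 |(z n).1| + min 1 |(z n).2|) := fun z n => by positivity
  have hle : ∀ z : ℕ → ℝ × ℝ, ∀ n,
      (1 / 2 : ℝ) ^ n * (min 1 |(z n).1| + min 1 |(z n).2|) ≤ (1 / 2 : ℝ) ^ n * 2 := fun z n =>
    mul_le_mul_of_nonneg_left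
      (by linarith [min_le_left 1 |(z n).1|, min_le_left 1 |(z n).2|]) (by positivity)
  have hsz : ∀ z : ℕ → ℝ × ℝ, Summable fun n =>
      (1 / 2 : ℝ) ^ n * (min 1 |(z n).1| + min 1 |(z n).2|) := fun z =>
    Summable.of_nonneg_of_le (hnn z) (hle z) hsum
  have hΦc : Continuous Φ := by
    refine continuous_tsum (fun n => by fun_prop) hsum fun n z => ?_
    rw [Real.norm_of_nonneg (hnn z n)]
    exact hle z n
  refine ⟨fun x => Φ fun n => (g n x, g n x⁻¹), ?_, ?_, ⟨∑' n : ℕ, (1 / 2 : ℝ) ^ n * 2, ?_⟩, ?_, ?_,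
    ?_, ?_⟩
  · exact hΦc.comp (continuous_pi fun n => (hgc n).prodMk ((hgc n).comp continuous_inv))
  · refine HasDoubleLimits.comp (F := fun x y n => (g n (x * y), g n (x * y)⁻¹)) ?_ hΦc
    refine HasDoubleLimits.pi (F := fun n x y => (g n (x * y), g n (x * y)⁻¹)) fun n => ?_
    refine (hgd n).prodMk ?_
    -- Inversion reverses products, so the two variables are exchanged.
    simpa using ((hgd n).comap (·⁻¹) (·⁻¹)).swap
  · intro x
    rw [abs_of_nonneg (tsum_nonneg (hnn _))]
    exact (hsz _).tsum_le_tsum (hle _) hsum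
  · exact fun x => tsum_nonneg (hnn _)
  · simp [hΦ, hg1]
  · intro x
    simp only [hΦ, inv_inv]
    exact tsum_congr fun n => by rw [add_comm]
  · intro V hV
    obtain ⟨n, -, hn⟩ := hN.1.mem_iff.1 hV
    refine ⟨(1 / 2) ^ n, by positivity, fun x hx => hn ?_⟩
    by_contra hxN
    have h1 := (hsz fun n => (g n x, g n x⁻¹)).le_tsum n fun m _ =>
      hnn (fun n => (g n x, g n x⁻¹)) m
    have h2 : (1 / 2 : ℝ) ^ n * 1 ≤ (1 / 2 : ℝ) ^ n * (min 1 |g n x| + min 1 |g n x⁻¹|) := by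
      refine mul_le_mul_of_nonneg_left ?_ (by positivity)
      rw [hgN n x hxN]
      simp
    simp only [hΦ] at hx
    linarith

lemma TopologyInducedByWAP.exists_isInducing {G : Type*} [Group G] [TopologicalSpace G]
    [IsTopologicalGroup G] (hG : TopologyInducedByWAP G) :
    ∃ F : G → {f : G →ᵇ ℂ // IsWeaklyAlmostPeriodic f} → ℂ,
      IsInducing F ∧ HasDoubleLimits fun x y => F (x * y) := by
  refine ⟨fun x f => f.1 x, ⟨?_⟩, HasDoubleLimits.pi fun f => f.2.hasDoubleLimits⟩
  rw [Pi.topologicalSpace, induced_iInf]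
  simp only [induced_compose]
  exact hG

/-- Matrix coefficients induce the weak operator topology, and `ψ (π (x * y) u)` pairs the bounded
functionals `ψ ∘ π x` with the bounded orbit `π y u`. -/
lemma HasReflexiveRepresentation.exists_isInducing {𝕜 : Type w} [RCLike 𝕜] {G : Type u} [Group G]
    [TopologicalSpace G] (hG : HasReflexiveRepresentation.{u, v, w} 𝕜 G) :
    ∃ (E : Type v) (_ : NormedAddCommGroup E) (_ : NormedSpace 𝕜 E)
      (F : G → E × StrongDual 𝕜 E → 𝕜),
      IsInducing F ∧ HasDoubleLimits fun x y => F (x * y) := by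
  obtain ⟨E, _, _, _, hE, π, hπ⟩ := hG
  refine ⟨E, _, _, fun g p => p.2 (π g p.1), ?_, ?_⟩
  · exact (ContinuousLinearMapWOT.isInducing_inducingFn (σ := RingHom.id 𝕜) (E := E) (F := E)).comp hπ.isInducing
  · refine HasDoubleLimits.pi fun p => ?_
    have h := hasDoubleLimits_pairing (𝕜 := 𝕜) (S := fun y => π y p.1)
      (fun U => hE.exists_forall_tendsto (R := ‖p.1‖) (fun y => by simp) U)
      (T := fun x => p.2.comp ((π x).toContinuousLinearEquiv : E →L[𝕜] E)) (R := ‖p.2‖)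
      (fun x => by
        refine ContinuousLinearMap.opNorm_le_bound _ (norm_nonneg _) fun u => ?_
        simpa using p.2.le_opNorm (π x u))
    simpa using h.swap

/-- A function with the double limit property gives rise to a stable distance. -/
lemma HasDoubleLimits.isStableDist {G : Type*} [Group G] {ρ : G → ℝ}
    (hρ : HasDoubleLimits fun x y => ρ (x * y)) : IsStableDist fun x y => ρ (x⁻¹ * y) :=
  fun s t _ U V => hρ.comap (fun n => (s n)⁻¹) t U V

theorem exists_continuous_gauge {𝕜 : Type w} [RCLike 𝕜] {G : Type u} [Group G]
    [TopologicalSpace G] [IsTopologicalGroup G] [FirstCountableTopology G]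
    (hG : IsReflexivelyRepresentable.{u, v, w} 𝕜 G) :
    ∃ f : G → ℝ, Continuous f ∧ (HasDoubleLimits fun x y => f (x * y)) ∧
      (∃ M, ∀ x, |f x| ≤ M) ∧ (∀ x, 0 ≤ f x) ∧ f 1 = 0 ∧ (∀ x, f x⁻¹ = f x) ∧
      ∀ N ∈ 𝓝 (1 : G), ∃ η > 0, ∀ x, f x < η → x ∈ N := by
  rcases hG with hG | hG
  · obtain ⟨E, _, _, F, hF, hd⟩ := hG.exists_isInducing
    exact HasDoubleLimits.exists_gauge hF hd
  · obtain ⟨F, hF, hd⟩ := hG.exists_isInducing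
    exact HasDoubleLimits.exists_gauge hF hd

/-! ### The length function and the stable metric. -/

/-- A reflexively representable metrizable group carries a continuous length function with the
double limit property that defines its topology. -/
theorem exists_length_hasDoubleLimits {𝕜 : Type w} [RCLike 𝕜] {G : Type u} [Group G]
    [TopologicalSpace G] [IsTopologicalGroup G] [FirstCountableTopology G]
    (hG : IsReflexivelyRepresentable.{u, v, w} 𝕜 G) :
    ∃ ρ : G → ℝ, Continuous ρ ∧ (HasDoubleLimits fun x y => ρ (x * y)) ∧ ρ 1 = 0 ∧
      (∀ x, ρ x⁻¹ = ρ x) ∧ (∀ x y, ρ (x * y) ≤ ρ x + ρ y) ∧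
      ∀ N ∈ 𝓝 (1 : G), ∃ η > 0, ∀ x, ρ x < η → x ∈ N := by
  obtain ⟨f, hfc, hfd, ⟨M, hM⟩, hf0, hf1, hfi, hfN⟩ := exists_continuous_gauge hG
  have hright : ∀ ε > 0, ∃ C ≥ 0, ∀ x y, f (x * y) ≤ f x + ε + C * f y := by
    intro ε hε
    obtain ⟨η, hη, hfη⟩ := hfN _ (hfd.eventually_abs_mul_sub_le hfc hM hε)
    have hM0 : 0 ≤ M := (abs_nonneg _).trans (hM 1)
    -- If `f y < η`, uniform continuity gives the bound; otherwise `M / η * f y ≥ M` already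
    -- dominates `f (x * y)`.
    refine ⟨M / η, by positivity, fun x y => ?_⟩
    rcases lt_or_ge (f y) η with hy | hy
    · have h1 := (abs_le.1 (hfη y hy x)).2
      have h2 : 0 ≤ M / η * f y := mul_nonneg (by positivity) (hf0 y)
      linarith
    · have h1 : M / η * η ≤ M / η * f y := mul_le_mul_of_nonneg_left hy (by positivity)
      rw [div_mul_cancel₀ _ hη.ne'] at h1
      linarith [(abs_le.1 (hM (x * y))).2, hf0 x]
  obtain ⟨h, hc, h0, hmin, hsub⟩ := exists_continuous_subadditive_comp hf0 fun ε hε => by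
    obtain ⟨C, hC0, hC⟩ := hright ε hε
    refine ⟨C, hC0, fun x y => ⟨hC x y, ?_⟩⟩
    have := hC y⁻¹ x⁻¹
    rwa [← mul_inv_rev, hfi, hfi, hfi] at this
  refine ⟨fun x => h (f x), hc.comp hfc, hfd.comp hc, by simp only [hf1, h0],
    fun x => by simp only [hfi], hsub, fun N hN => ?_⟩
  obtain ⟨η, hη, H⟩ := hfN N hN
  refine ⟨min 1 η, by positivity, fun x hx => H x ?_⟩
  have hlt := (hmin _ (hf0 x)).trans_lt hx
  by_contra hcon
  exact absurd hlt (not_lt.2 (min_le_min_left _ (not_lt.1 hcon)))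

theorem theorem3p3 {𝕜 : Type w} [RCLike 𝕜]
    {G : Type u} [Group G] [d : MetricSpace G] [IsTopologicalGroup G]
    (hd : IsLeftInvariantDist d.dist)
    (hG : IsReflexivelyRepresentable.{u, v, w} 𝕜 G) :
    ∃ δ : MetricSpace G,
      IsLeftInvariantDist δ.dist ∧ IsStableDist δ.dist ∧
        UniformlyEquivalentDist d.dist δ.dist := by
  obtain ⟨ρ, hρc, hρd, hρ1, hρi, hρm, hρN⟩ := exists_length_hasDoubleLimits hG
  have hequiv : UniformlyEquivalentDist d.dist fun x y => ρ (x⁻¹ * y) := by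
    intro ε hε
    -- Left invariance reduces uniform equivalence to comparing neighbourhoods of 1.
    have hdist : ∀ x y : G, d.dist x y = d.dist (x⁻¹ * y) 1 := fun x y => by
      rw [← hd x⁻¹ x y, inv_mul_cancel]
      exact dist_comm _ _
    obtain ⟨η₁, hη₁, H₁⟩ := hρN _ (Metric.ball_mem_nhds (1 : G) hε)
    obtain ⟨η₂, hη₂, H₂⟩ := Metric.mem_nhds_iff.1
      ((hρc.tendsto 1).eventually (gt_mem_nhds (hρ1.trans_lt hε)))
    refine ⟨min η₁ η₂, lt_min hη₁ hη₂, fun x y => ⟨fun hxy => ?_, fun hxy => ?_⟩⟩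
    · rw [hdist] at hxy
      exact H₂ (hxy.trans_le (min_le_right _ _))
    · rw [hdist]
      exact H₁ _ (lt_of_lt_of_le hxy (min_le_left _ _))
  let δ : MetricSpace G :=
    { dist := fun x y => ρ (x⁻¹ * y)
      dist_self := fun x => by simpa using hρ1
      dist_comm := fun x y => by rw [← hρi]; simp
      dist_triangle := fun x y z => by
        simpa [mul_assoc] using hρm (x⁻¹ * y) (y⁻¹ * z)
      eq_of_dist_eq_zero := fun {x y} hxy => by
        by_contra hne
        have hne' : x⁻¹ * y ≠ 1 := fun h => hne (inv_mul_eq_one.1 h)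
        obtain ⟨η, hη, H⟩ := hρN {x⁻¹ * y}ᶜ (isOpen_compl_singleton.mem_nhds hne'.symm)
        exact H (x⁻¹ * y) (lt_of_eq_of_lt hxy hη) rfl }
  refine ⟨δ, fun g x y => ?_, hρd.isStableDist, hequiv⟩
  change ρ ((g * x)⁻¹ * (g * y)) = ρ (x⁻¹ * y)
  congr 1
  group
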